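/- Let $\mathbb{P}$ be the set of positive integers with its usual order and $\mathbb{P}^*$ the set of finite words over $\mathbb{P}$. For $u,w\in\mathbb{P}^*$ say that $w$ embeds $u$ if some string $v$ of $|u|$ consecutive letters of $w$ satisfies $v_i\ge u_i$ for all $1\le i\le |u|$. Let $\mathcal{F}(u)$ be the set of all $w\in\mathbb{P}^*$ that embed $u$, and let $$F(u;t,x)=\sum_{w\in\mathcal{F}(u)}t^{|w|}x^{\Sigma(w)},$$ a formal power series in $t$ and $x$, where $|w|$ is the length of $w$ and $\Sigma(w)$ is the sum of its letters. Two words $u,v\in\mathbb{P}^*$ are Wilf equivalent if $F(u;t,x)=F(v;t,x)$. Then for all positive integers $a<b\le c$, a word $v\in\mathbb{P}^*$ (of any length) is Wilf equivalent to the three-letter word $bac$ if and only if $v=bac$ or $v=cab$. -/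

import Mathlib

/-- `u ≤ w` in the generalized factor order: some string `v` of `|u|` consecutive letters of `w`
dominates `u` letter by letter. -/
def GenFactorLE {P : Type*} [LE P] (u w : List P) : Prop :=
  ∃ v : List P, v <:+: w ∧ List.Forall₂ (fun p q => p ≤ q) u v

/-- `Σ(w)`, the sum of the letters of a word over the positive integers. -/
def letterSum (w : List ℕ+) : ℕ := (w.map (fun p : ℕ+ => (p : ℕ))).sum

/-- `𝓕(u)`, the set of words over the positive integers that embed `u`. -/
def embedders (u : List ℕ+) : Set (List ℕ+) := {w | GenFactorLE u w}

/-- The weight `t ^ |w| * x ^ Σ(w)`, as a formal power series in `t = X 0` and `x = X 1`. -/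
noncomputable def wt (w : List ℕ+) : MvPowerSeries (Fin 2) ℤ :=
  MvPowerSeries.X 0 ^ w.length * MvPowerSeries.X 1 ^ letterSum w

/-- `F(u; t, x) = ∑_{w ∈ 𝓕(u)} wt(w)`, the formal sum being taken coefficient by coefficient.
Every coefficient receives only finitely many nonzero contributions, see
`finite_coeff_wt_ne_zero`. -/
noncomputable def weightGenFun (u : List ℕ+) : MvPowerSeries (Fin 2) ℤ :=
  fun m => ∑ᶠ w ∈ embedders u, MvPowerSeries.coeff m (wt w)

/-- Wilf equivalence of words over the positive integers. -/
def WilfEquiv (u v : List ℕ+) : Prop := weightGenFun u = weightGenFun v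

theorem coeff_wt (m : Fin 2 →₀ ℕ) (w : List ℕ+) :
    MvPowerSeries.coeff m (wt w) = if m 0 = w.length ∧ m 1 = letterSum w then 1 else 0 := by
  classical
  rw [wt, MvPowerSeries.X_pow_eq, MvPowerSeries.X_pow_eq, MvPowerSeries.monomial_mul_monomial,
    MvPowerSeries.coeff_monomial]
  have h : m = Finsupp.single 0 w.length + Finsupp.single 1 (letterSum w) ↔
      m 0 = w.length ∧ m 1 = letterSum w := by
    rw [Finsupp.ext_iff, Fin.forall_fin_two]
    simp
  simp only [h, mul_one]

theorem finite_words (n s : ℕ) : {w : List ℕ+ | n = w.length ∧ s = letterSum w}.Finite := by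
  refine Set.Finite.subset (List.finite_length_eq (Fin (s + 1)) n |>.image
    (List.map (fun i => i.val.toPNat'))) ?_
  rintro w ⟨hn, hs⟩
  have hle : ∀ p ∈ w, (p : ℕ) < s + 1 := fun p hp => by
    rw [hs, Nat.lt_succ_iff]
    exact List.single_le_sum (by simp) _ (List.mem_map_of_mem hp)
  refine ⟨w.pmap (fun (p : ℕ+) hp => ⟨(p : ℕ), hp⟩) hle, by simp [hn], ?_⟩
  rw [List.map_pmap]
  simp

theorem finite_coeff_wt_ne_zero (m : Fin 2 →₀ ℕ) :
    {w : List ℕ+ | MvPowerSeries.coeff m (wt w) ≠ 0}.Finite := by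
  refine (finite_words (m 0) (m 1)).subset fun w hw => ?_
  simpa [coeff_wt] using hw

/-! Reversal gives `bac ~ cab`. Conversely, Wilf equivalence preserves length and letter sum, so `v
= pqr`. Words embedding `pqr` are unions of `dominators` of the shifts of `pqr` padded with 1s;
intersections are dominators of letterwise maxima, and each such count depends only on length and
letter sum. Inclusion–exclusion at length 4 recovers the sum of the overlap of adjacent shifts
(`WilfEquiv.sum_max_eq`). At length 5 it then leaves the outer pair and the triple overlap,
separated by `eq_and_eq_of_dominatorCount_add`. These sums determine `v` up to reversal. -/

/-- The words of length `n` and letter sum `s` that embed `u`. -/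
def embeddersOf (u : List ℕ+) (n s : ℕ) : Set (List ℕ+) :=
  {w | GenFactorLE u w ∧ n = w.length ∧ s = letterSum w}

/-- The words of letter sum `s` that dominate `m` letter by letter. -/
def dominators (m : List ℕ+) (s : ℕ) : Set (List ℕ+) :=
  {w | List.Forall₂ (fun p q => p ≤ q) m w ∧ s = letterSum w}

/-- The number of words of length `n` over `ℕ` whose sum is `s - a` (none if `s < a`). By
`ncard_dominators` it is the number of words of letter sum `s` dominating a given word of length `n`
and letter sum `a`. -/
noncomputable def dominatorCount (n a s : ℕ) : ℕ :=
  {k : List ℕ | k.length = n ∧ k.sum + a = s}.ncard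

@[simp] theorem letterSum_nil : letterSum [] = 0 := rfl

@[simp] theorem letterSum_cons (p : ℕ+) (w : List ℕ+) :
    letterSum (p :: w) = p + letterSum w := by simp [letterSum]

theorem letterSum_reverse (w : List ℕ+) : letterSum w.reverse = letterSum w := by
  simp [letterSum, List.map_reverse, List.sum_reverse]

theorem finite_embeddersOf (u : List ℕ+) (n s : ℕ) : (embeddersOf u n s).Finite :=
  (finite_words n s).subset fun _ hw => hw.2

theorem finite_dominators (m : List ℕ+) (s : ℕ) : (dominators m s).Finite :=
  (finite_words m.length s).subset fun _ hw => ⟨hw.1.length_eq, hw.2⟩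

theorem weightGenFun_apply (u : List ℕ+) (m : Fin 2 →₀ ℕ) :
    weightGenFun u m = (embeddersOf u (m 0) (m 1)).ncard := by
  classical
  have h : ∀ w : List ℕ+, (∑ᶠ (_ : w ∈ embedders u), MvPowerSeries.coeff m (wt w)) =
      ∑ᶠ (_ : w ∈ embeddersOf u (m 0) (m 1)), (1 : ℤ) := by
    intro w
    rw [finsum_eq_if, finsum_eq_if, coeff_wt, ← ite_and]
    congr 1
  rw [weightGenFun, finsum_congr h, finsum_mem_eq_finite_toFinset_sum _ (finite_embeddersOf u _ _),
    Set.ncard_eq_toFinset_card _ (finite_embeddersOf u _ _)]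
  simp

theorem wilfEquiv_iff {u v : List ℕ+} :
    WilfEquiv u v ↔ ∀ n s, (embeddersOf u n s).ncard = (embeddersOf v n s).ncard := by
  refine ⟨fun h n s => ?_, fun h => funext fun m => ?_⟩
  · have := congrFun h (Finsupp.single 0 n + Finsupp.single 1 s)
    rw [weightGenFun_apply, weightGenFun_apply] at this
    simpa using this
  · rw [weightGenFun_apply, weightGenFun_apply, h]

/-! ### Length, letter sum and reversal -/

theorem letterSum_le_of_forall₂ {u v : List ℕ+} (h : List.Forall₂ (fun p q => p ≤ q) u v) :
    letterSum u ≤ letterSum v := by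
  induction h with
  | nil => rfl
  | cons h _ ih =>
    simp only [letterSum_cons]
    exact add_le_add (by exact_mod_cast h) ih

/-- Since `u` embeds itself, the coefficient at its length and sum is nonzero. -/
theorem exists_embedder_of_wilfEquiv {u v : List ℕ+} (h : WilfEquiv u v) :
    ∃ w, GenFactorLE v w ∧ u.length = w.length ∧ letterSum u = letterSum w := by
  have hu : u ∈ embeddersOf u u.length (letterSum u) :=
    ⟨⟨u, List.infix_rfl, List.forall₂_same.2 fun _ _ => le_rfl⟩, rfl, rfl⟩
  have hpos := (Set.ncard_pos (finite_embeddersOf u _ _)).2 ⟨u, hu⟩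
  rw [wilfEquiv_iff.1 h] at hpos
  exact (Set.ncard_pos (finite_embeddersOf v _ _)).1 hpos

theorem WilfEquiv.symm {u v : List ℕ+} (h : WilfEquiv u v) : WilfEquiv v u := Eq.symm h

theorem WilfEquiv.length_le {u v : List ℕ+} (h : WilfEquiv u v) : v.length ≤ u.length := by
  obtain ⟨w, ⟨x, hx, hvx⟩, hw, -⟩ := exists_embedder_of_wilfEquiv h
  rw [hvx.length_eq, hw]
  exact hx.length_le

theorem WilfEquiv.length_eq {u v : List ℕ+} (h : WilfEquiv u v) : u.length = v.length :=
  le_antisymm h.symm.length_le h.length_le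

theorem WilfEquiv.letterSum_le {u v : List ℕ+} (h : WilfEquiv u v) :
    letterSum v ≤ letterSum u := by
  obtain ⟨w, ⟨x, hx, hvx⟩, hw, hs⟩ := exists_embedder_of_wilfEquiv h
  obtain rfl : x = w := hx.eq_of_length (by rw [← hvx.length_eq, ← hw, h.length_eq])
  exact hs ▸ letterSum_le_of_forall₂ hvx

theorem WilfEquiv.letterSum_eq {u v : List ℕ+} (h : WilfEquiv u v) :
    letterSum u = letterSum v :=
  le_antisymm h.symm.letterSum_le h.letterSum_le

theorem GenFactorLE.reverse {u w : List ℕ+} (h : GenFactorLE u w) :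
    GenFactorLE u.reverse w.reverse := by
  obtain ⟨x, hx, hux⟩ := h
  exact ⟨x.reverse, List.reverse_infix.2 hx, List.forall₂_reverse_iff.2 hux⟩

theorem wilfEquiv_reverse (u : List ℕ+) : WilfEquiv u u.reverse := by
  refine wilfEquiv_iff.2 fun n s => ?_
  rw [← Set.ncard_image_of_injective _ List.reverse_injective]
  congr 1
  ext w
  refine ⟨?_, fun ⟨h, hn, hs⟩ => ⟨w.reverse, ⟨?_, ?_, ?_⟩, w.reverse_reverse⟩⟩
  · rintro ⟨w, ⟨h, hn, hs⟩, rfl⟩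
    exact ⟨h.reverse, by simpa using hn, by rwa [letterSum_reverse]⟩
  · simpa using h.reverse
  · simpa using hn
  · rwa [letterSum_reverse]

/-! ### Counting dominators -/

/-- The sum of a positive and a natural number. -/
def addNat (p : ℕ+) (i : ℕ) : ℕ+ := ⟨p + i, by positivity⟩

@[simp] theorem coe_addNat (p : ℕ+) (i : ℕ) : (addNat p i : ℕ) = p + i := rfl

theorem exists_add_of_forall₂ {m w : List ℕ+} (h : List.Forall₂ (fun p q => p ≤ q) m w) :
    ∃ k : List ℕ, k.length = m.length ∧ k.sum + letterSum m = letterSum w ∧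
      List.zipWith addNat m k = w := by
  induction h with
  | nil => exact ⟨[], rfl, rfl, rfl⟩
  | @cons p q m w hpq _ ih =>
    obtain ⟨k, hk, hs, rfl⟩ := ih
    have hpq' : (p : ℕ) ≤ q := by exact_mod_cast hpq
    refine ⟨(q - p : ℕ) :: k, by simp [hk], ?_, ?_⟩
    · simp only [List.sum_cons, letterSum_cons]
      omega
    · simp only [List.zipWith_cons_cons, List.cons.injEq, and_true]
      exact PNat.eq (by rw [coe_addNat]; omega)

theorem forall₂_zipWith_add (m : List ℕ+) (k : List ℕ) (h : k.length = m.length) :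
    List.Forall₂ (fun p q => p ≤ q) m
      (List.zipWith addNat m k) ∧
    letterSum (List.zipWith addNat m k) =
      k.sum + letterSum m := by
  induction m generalizing k with
  | nil =>
    obtain rfl : k = [] := by simpa using h
    exact ⟨List.Forall₂.nil, rfl⟩
  | cons p m ih =>
    obtain _ | ⟨i, k⟩ := k
    · simp at h
    · obtain ⟨h₁, h₂⟩ := ih k (by simpa using h)
      refine ⟨List.Forall₂.cons ?_ h₁, ?_⟩
      · rw [← PNat.coe_le_coe]
        simp
      · simp only [List.zipWith_cons_cons, letterSum_cons, List.sum_cons, h₂, coe_addNat]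
        omega

theorem zipWith_add_injOn (m : List ℕ+) (k l : List ℕ) (hk : k.length = m.length)
    (hl : l.length = m.length)
    (h : List.zipWith addNat m k =
      List.zipWith addNat m l) : k = l := by
  induction m generalizing k l with
  | nil => simp_all
  | cons p m ih =>
    obtain _ | ⟨i, k⟩ := k
    · simp at hk
    obtain _ | ⟨j, l⟩ := l
    · simp at hl
    simp only [List.zipWith_cons_cons, List.cons.injEq] at h
    have hij := congrArg (fun x : ℕ+ => (x : ℕ)) h.1
    simp only [coe_addNat, add_right_inj] at hij
    rw [hij, ih k l (by simpa using hk) (by simpa using hl) h.2]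

theorem ncard_dominators (m : List ℕ+) (s : ℕ) :
    (dominators m s).ncard = dominatorCount m.length (letterSum m) s := by
  have hinj : Set.InjOn (List.zipWith addNat m)
      {k | k.length = m.length ∧ k.sum + letterSum m = s} :=
    fun k hk l hl h => zipWith_add_injOn m k l hk.1 hl.1 h
  rw [dominatorCount, ← hinj.ncard_image]
  congr 1
  ext w
  constructor
  · rintro ⟨h, rfl⟩
    obtain ⟨k, hk, hs, hw⟩ := exists_add_of_forall₂ h
    exact ⟨k, ⟨hk, hs⟩, hw⟩
  · rintro ⟨k, ⟨hk, rfl⟩, rfl⟩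
    obtain ⟨h₁, h₂⟩ := forall₂_zipWith_add m k hk
    exact ⟨h₁, h₂.symm⟩

theorem dominatorCount_eq_zero {n a s : ℕ} (h : s < a) : dominatorCount n a s = 0 := by
  rw [dominatorCount, Set.eq_empty_of_forall_notMem (s := {k : List ℕ | _}), Set.ncard_empty]
  rintro k ⟨-, hk⟩
  omega

theorem dominatorCount_self (n a : ℕ) : dominatorCount n a a = 1 := by
  rw [dominatorCount, Set.ncard_eq_one]
  refine ⟨List.replicate n 0, Set.ext fun k => ?_⟩
  simp [List.eq_replicate_iff, List.sum_eq_zero_iff]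

/-- The parameter `a` is the least `s` at which the count is nonzero. -/
theorem dominatorCount_injective {n a b : ℕ}
    (h : ∀ s, dominatorCount n a s = dominatorCount n b s) : a = b := by
  have ha := h a
  have hb := h b
  rw [dominatorCount_self] at ha hb
  rcases lt_trichotomy a b with hab | hab | hab
  · simp [dominatorCount_eq_zero hab] at ha
  · exact hab
  · simp [dominatorCount_eq_zero hab] at hb

/-- Compare the lowest nonzero terms. Strictness of `a < b` is what prevents the terms in `a` and
`b` from cancelling. -/
theorem eq_and_eq_of_dominatorCount_add {n a b c d : ℕ} (hab : a < b) (hcd : c ≤ d)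
    (h : ∀ s, dominatorCount n a s + dominatorCount n d s =
      dominatorCount n c s + dominatorCount n b s) : a = c ∧ b = d := by
  have hac : a = c := by
    have ha := h a
    have hc := h c
    rw [dominatorCount_self, dominatorCount_eq_zero hab] at ha
    rw [dominatorCount_self] at hc
    rcases lt_trichotomy a c with hac | hac | hac
    · rw [dominatorCount_eq_zero hac] at ha
      omega
    · exact hac
    · rw [dominatorCount_eq_zero hac, dominatorCount_eq_zero (hac.trans hab)] at hc
      rcases hcd.eq_or_lt with rfl | hcd
      · omega
      · rw [dominatorCount_eq_zero hcd] at hc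
        omega
  subst hac
  exact ⟨rfl, dominatorCount_injective (n := n) fun s => by have := h s; omega⟩

/-! ### Embeddings into words of length 4 and 5 -/

theorem genFactorLE_cons (p q r x y z : ℕ+) (w : List ℕ+) :
    GenFactorLE [p, q, r] (x :: y :: z :: w) ↔
      (p ≤ x ∧ q ≤ y ∧ r ≤ z) ∨ GenFactorLE [p, q, r] (y :: z :: w) := by
  constructor
  · rintro ⟨v, hv, h⟩
    rcases List.infix_cons_iff.1 hv with hv | hv
    · obtain _ | ⟨h₁, _ | ⟨h₂, _ | ⟨h₃, _ | _⟩⟩⟩ := h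
      simp only [List.cons_prefix_cons, List.nil_prefix, and_true] at hv
      obtain ⟨rfl, rfl, rfl⟩ := hv
      exact Or.inl ⟨h₁, h₂, h₃⟩
    · exact Or.inr ⟨v, hv, h⟩
  · rintro (⟨h₁, h₂, h₃⟩ | ⟨v, hv, h⟩)
    · exact ⟨[x, y, z], ⟨[], w, rfl⟩, .cons h₁ (.cons h₂ (.cons h₃ .nil))⟩
    · exact ⟨v, List.infix_cons_iff.2 (Or.inr hv), h⟩

theorem not_genFactorLE_pair (p q r x y : ℕ+) : ¬ GenFactorLE [p, q, r] [x, y] := by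
  rintro ⟨v, hv, h⟩
  have h₁ := h.length_eq
  have h₂ := hv.length_le
  simp only [List.length_cons, List.length_nil] at h₁ h₂
  omega

/-- Padding with 1, the least letter, imposes no condition. -/
theorem embeddersOf_four (p q r : ℕ+) (s : ℕ) :
    embeddersOf [p, q, r] 4 s = dominators [p, q, r, 1] s ∪ dominators [1, p, q, r] s := by
  ext w
  simp only [embeddersOf, dominators, Set.mem_union, Set.mem_ofPred_eq]
  constructor
  · rintro ⟨h, hn, hs⟩
    obtain ⟨x, y, z, t, rfl⟩ := List.length_eq_four.1 hn.symm
    simp only [genFactorLE_cons, not_genFactorLE_pair, or_false] at h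
    simpa [← hs] using h
  · rintro (⟨h, hs⟩ | ⟨h, hs⟩) <;>
    · obtain ⟨x, y, z, t, rfl⟩ := List.length_eq_four.1 h.length_eq.symm
      simp only [List.forall₂_cons, List.Forall₂.nil, and_true] at h
      simp [genFactorLE_cons, h, hs]

theorem embeddersOf_five (p q r : ℕ+) (s : ℕ) :
    embeddersOf [p, q, r] 5 s = dominators [p, q, r, 1, 1] s ∪
      (dominators [1, p, q, r, 1] s ∪ dominators [1, 1, p, q, r] s) := by
  ext w
  simp only [embeddersOf, dominators, Set.mem_union, Set.mem_ofPred_eq]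
  constructor
  · rintro ⟨h, hn, hs⟩
    obtain _ | ⟨x₁, _ | ⟨x₂, _ | ⟨x₃, _ | ⟨x₄, _ | ⟨x₅, _ | ⟨x₆, w⟩⟩⟩⟩⟩⟩ := w <;>
      simp only [List.length_cons, List.length_nil] at hn <;> try omega
    simp only [genFactorLE_cons, not_genFactorLE_pair, or_false] at h
    simpa [← hs] using h
  · rintro (⟨h, hs⟩ | ⟨h, hs⟩ | ⟨h, hs⟩) <;>
    · have hn := h.length_eq
      obtain _ | ⟨x₁, _ | ⟨x₂, _ | ⟨x₃, _ | ⟨x₄, _ | ⟨x₅, _ | ⟨x₆, w⟩⟩⟩⟩⟩⟩ := w <;>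
        simp only [List.length_cons, List.length_nil] at hn <;> try omega
      simp only [List.forall₂_cons, List.Forall₂.nil, and_true] at h
      simp [genFactorLE_cons, h, hs]

theorem forall₂_zipWith_max {m m' w : List ℕ+} (h : m.length = m'.length) :
    List.Forall₂ (fun p q => p ≤ q) (List.zipWith max m m') w ↔
      List.Forall₂ (fun p q => p ≤ q) m w ∧ List.Forall₂ (fun p q => p ≤ q) m' w := by
  induction m generalizing m' w with
  | nil =>
    obtain rfl : m' = [] := by simpa using h.symm
    simp
  | cons p m ih =>
    obtain _ | ⟨p', m'⟩ := m'
    · simp at h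
    obtain _ | ⟨q, w⟩ := w
    · simp
    simp only [List.zipWith_cons_cons, List.forall₂_cons, max_le_iff, ih (by simpa using h)]
    tauto

theorem dominators_inter {m m' : List ℕ+} (h : m.length = m'.length) (s : ℕ) :
    dominators m s ∩ dominators m' s = dominators (List.zipWith max m m') s := by
  ext w
  simp only [dominators, Set.mem_inter_iff, Set.mem_ofPred_eq, forall₂_zipWith_max h]
  tauto

theorem coe_max (p q : ℕ+) : ((max p q : ℕ+) : ℕ) = max (p : ℕ) q :=
  Monotone.map_max fun _ _ h => h

theorem ncard_union_dominators {m m' : List ℕ+} (h : m.length = m'.length) (s : ℕ) :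
    (dominators m s ∪ dominators m' s).ncard + (dominators (List.zipWith max m m') s).ncard =
      (dominators m s).ncard + (dominators m' s).ncard := by
  rw [← dominators_inter h]
  exact Set.ncard_union_add_ncard_inter _ _ (finite_dominators _ _) (finite_dominators _ _)

theorem ncard_union_dominators_three {m₁ m₂ m₃ : List ℕ+} (h₁₂ : m₁.length = m₂.length)
    (h₂₃ : m₂.length = m₃.length) (s : ℕ) :
    (dominators m₁ s ∪ (dominators m₂ s ∪ dominators m₃ s)).ncard +
        (dominators (List.zipWith max m₁ m₂) s).ncard +
        (dominators (List.zipWith max m₂ m₃) s).ncard +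
        (dominators (List.zipWith max m₁ m₃) s).ncard =
      (dominators m₁ s).ncard + (dominators m₂ s).ncard + (dominators m₃ s).ncard +
        (dominators (List.zipWith max (List.zipWith max m₁ m₂) (List.zipWith max m₁ m₃)) s).ncard := by
  have h := Set.ncard_union_add_ncard_inter (dominators m₁ s) (dominators m₂ s ∪ dominators m₃ s)
    (finite_dominators _ _) ((finite_dominators _ _).union (finite_dominators _ _))
  rw [Set.inter_union_distrib_left, dominators_inter h₁₂, dominators_inter (h₁₂.trans h₂₃)] at h
  have h' := ncard_union_dominators h₂₃ s
  have h'' := ncard_union_dominators (m := List.zipWith max m₁ m₂) (m' := List.zipWith max m₁ m₃)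
    (by simp [h₁₂, h₂₃]) s
  omega

theorem ncard_embeddersOf_four (p q r : ℕ+) (s : ℕ) :
    (embeddersOf [p, q, r] 4 s).ncard +
        dominatorCount 4 (p + max (p : ℕ) q + max (q : ℕ) r + r) s =
      2 * dominatorCount 4 (p + q + r + 1) s := by
  have h := ncard_union_dominators (m := [p, q, r, 1]) (m' := [1, p, q, r]) rfl s
  rw [← embeddersOf_four] at h
  simp only [ncard_dominators, List.zipWith_cons_cons, List.zipWith_nil_left, List.length_cons,
    List.length_nil, letterSum_cons, letterSum_nil, coe_max, PNat.one_coe, zero_add,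
    Nat.reduceAdd] at h
  have hp := p.pos
  have hq := q.pos
  have hr := r.pos
  convert h using 2
  · congr 1
    omega
  · rw [two_mul]
    congr 2 <;> omega

/-- Both adjacent overlaps have the same letter sum, hence the factor 2. Moving the negative terms
across avoids truncated subtraction. -/
theorem ncard_embeddersOf_five (p q r : ℕ+) (s : ℕ) :
    (embeddersOf [p, q, r] 5 s).ncard +
        2 * dominatorCount 5 (p + max (p : ℕ) q + max (q : ℕ) r + r + 1) s +
        dominatorCount 5 (p + q + max (p : ℕ) r + q + r) s =
      3 * dominatorCount 5 (p + q + r + 2) s +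
        dominatorCount 5 (p + max (p : ℕ) q + max (max (p : ℕ) q) r + max (q : ℕ) r + r) s := by
  have h := ncard_union_dominators_three (m₁ := [p, q, r, 1, 1]) (m₂ := [1, p, q, r, 1])
    (m₃ := [1, 1, p, q, r]) rfl rfl s
  rw [← embeddersOf_five] at h
  have hd : ∀ x₁ x₂ x₃ x₄ x₅ : ℕ+, ∀ k : ℕ, (x₁ + x₂ + x₃ + x₄ + x₅ : ℕ) = k →
      (dominators [x₁, x₂, x₃, x₄, x₅] s).ncard = dominatorCount 5 k s := by
    rintro x₁ x₂ x₃ x₄ x₅ _ rfl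
    rw [ncard_dominators]
    simp [add_assoc]
  have hp := p.pos
  have hq := q.pos
  have hr := r.pos
  simp only [List.zipWith_cons_cons, List.zipWith_nil_left] at h
  rw [hd p q r 1 1 (p + q + r + 2) (by simp), hd 1 p q r 1 (p + q + r + 2) (by simp; omega),
    hd 1 1 p q r (p + q + r + 2) (by simp; omega),
    hd _ _ _ _ _ (p + max (p : ℕ) q + max (q : ℕ) r + r + 1)
      (by simp only [coe_max, PNat.one_coe]; omega),
    hd _ _ _ _ _ (p + max (p : ℕ) q + max (q : ℕ) r + r + 1)
      (by simp only [coe_max, PNat.one_coe]; omega),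
    hd _ _ _ _ _ (p + q + max (p : ℕ) r + q + r)
      (by simp only [coe_max, PNat.one_coe]; omega),
    hd _ _ _ _ _ (p + max (p : ℕ) q + max (max (p : ℕ) q) r + max (q : ℕ) r + r)
      (by simp only [coe_max, PNat.one_coe]; omega)] at h
  omega

/-! ### Recovering the word -/

theorem WilfEquiv.sum_max_eq {p q r p' q' r' : ℕ+} (h : WilfEquiv [p, q, r] [p', q', r']) :
    (p + max (p : ℕ) q + max (q : ℕ) r + r : ℕ) =
      p' + max (p' : ℕ) q' + max (q' : ℕ) r' + r' := by
  refine dominatorCount_injective (n := 4) fun s => ?_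
  have hs : (p + q + r : ℕ) = p' + q' + r' := by simpa [add_assoc] using h.letterSum_eq
  have h₁ := ncard_embeddersOf_four p q r s
  have h₂ := ncard_embeddersOf_four p' q' r' s
  rw [hs, wilfEquiv_iff.1 h] at h₁
  omega

theorem corollary4 (a b c : ℕ+) (hab : a < b) (hbc : b ≤ c) (v : List ℕ+) :
    WilfEquiv [b, a, c] v ↔ v = [b, a, c] ∨ v = [c, a, b] := by
  constructor
  · intro h
    obtain ⟨p, q, r, rfl⟩ := List.length_eq_three.1 h.length_eq.symm
    have hs : (b + a + c : ℕ) = p + q + r := by simpa [add_assoc] using h.letterSum_eq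
    have hm := h.sum_max_eq
    have hab' : (a : ℕ) < b := hab
    have hbc' : (b : ℕ) ≤ c := hbc
    obtain ⟨h₁, h₂⟩ := eq_and_eq_of_dominatorCount_add (n := 5)
      (a := b + a + max (b : ℕ) c + a + c)
      (b := b + max (b : ℕ) a + max (max (b : ℕ) a) c + max (a : ℕ) c + c)
      (c := p + q + max (p : ℕ) r + q + r)
      (d := p + max (p : ℕ) q + max (max (p : ℕ) q) r + max (q : ℕ) r + r)
      (by omega) (by omega) fun s => by
        have e₁ := ncard_embeddersOf_five b a c s
        have e₂ := ncard_embeddersOf_five p q r s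
        -- Single placements and adjacent overlaps now agree on both sides and cancel.
        rw [hs, hm, wilfEquiv_iff.1 h] at e₁
        omega
    -- Here `h₁` amounts to `q + max p r = a + c` and `h₂` to `max p q r = c`. So `q` and `max p r`
    -- are `a` and `c` in some order, and the remaining letter `min p r` is `b`. As `a < b`, this
    -- forces `q = a`.
    simp only [List.cons.injEq, and_true, ← PNat.coe_inj]
    omega
  · rintro (rfl | rfl)
    · rfl
    · exact wilfEquiv_reverse [b, a, c]
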